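/- Let $(\Omega,\mathcal F,\mathbb P)$ be a probability space and $\mathcal G\subseteq\mathcal F$ a $\sigma$-algebra. Let $L_{\mathcal F}\subseteq L^0(\Omega,\mathcal F,\mathbb P)$ and $L_{\mathcal G}\subseteq L^0(\Omega,\mathcal G,\mathbb P)$ be vector lattices (linear subspaces closed under $\vee$ and $\wedge$, for the $\mathbb P$-a.s. order) such that $X\mathbf 1_A\in L_{\mathcal F}$ for all $X\in L_{\mathcal F}$, $A\in\mathcal F$, and $Y\mathbf 1_A\in L_{\mathcal G}$ for all $Y\in L_{\mathcal G}$, $A\in\mathcal G$. Let $L_{\mathcal F}^*$ be the order continuous dual of $L_{\mathcal F}$, i.e. the space of linear functionals $\varphi:L_{\mathcal F}\to\mathbb R$ with $\varphi(X_\alpha)\to\varphi(X)$ for every net $X_\alpha$ that order converges to $X$ in $L_{\mathcal F}$. Assume that $L_{\mathcal F}^*\subseteq L^1(\Omega,\mathcal F,\mathbb P)$, in the sense that every $\varphi\in L_{\mathcal F}^*$ has the form $\varphi(X)=E_{\mathbb P}[ZX]$ for some $Z\in L^1$ with $ZX\in L^1$ for all $X\in L_{\mathcal F}$, and that $L_{\mathcal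 F}^*$ separates the points of $L_{\mathcal F}$. Let $\pi:L_{\mathcal F}\to L_{\mathcal G}$ satisfy (MON) $X\le Y\Rightarrow\pi(X)\le\pi(Y)$; (QCO) $\pi(\Lambda X+(1-\Lambda)Y)\le\pi(X)\vee\pi(Y)$ for all $X,Y\in L_{\mathcal F}$ and all $\mathcal G$-measurable $\Lambda$ with $0\le\Lambda\le1$ and $\Lambda X+(1-\Lambda)Y\in L_{\mathcal F}$; (REG) $\pi(X\mathbf 1_A+Y\mathbf 1_{A^c})=\pi(X)\mathbf 1_A+\pi(Y)\mathbf 1_{A^c}$ for all $X,Y\in L_{\mathcal F}$, $A\in\mathcal G$; (LSC) for every $Y\in L_{\mathcal G}$ the set $\{X\in L_{\mathcal F}\mid\pi(X)\le Y\}$ is closed in the weak topology $\sigma(L_{\mathcal F},L_{\mathcal F}^*)$. Let $L_{\mathcal F}^*\cap\mathcal P$ be the set of probability measures $Q\ll\mathbb P$ such that $X\mapsto E_{\mathbb P}[\frac{dQ}{d\mathbb P}X]$ is well defined on $L_{\mathcal F}$ (i.e. $\frac{dQ}{d\mathbb P}X\in L^1$ for all $X\in L_{\mathcal F}$) and belongs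 to $L_{\mathcal F}^*$. For $X\in L_{\mathcal F}$ and $Q\in L_{\mathcal F}^*\cap\mathcal P$ let $$K(X,Q):=\operatorname{ess\,inf}\{\pi(\xi)\mid \xi\in L_{\mathcal F},\ E_Q[\xi\mid\mathcal G]\ge E_Q[X\mid\mathcal G]\ Q\text{-a.s.}\},$$ a random variable with values in $[-\infty,\infty)$; essential infima and suprema are taken with respect to $\mathbb P$. Then for every $X\in L_{\mathcal F}$ $$\pi(X)=\operatorname*{ess\,sup}_{Q\in L_{\mathcal F}^*\cap\mathcal P}K(X,Q).$$ -/

import Mathlib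

open MeasureTheory Filter Topology

universe u

namespace QuasiconvexDual

/-! `Ω →ₘ[P] ℝ` is the space `L⁰(Ω, F, P)` of (classes of) a.s. finite random variables with its
a.s. order; `Ω →ₘ[P] EReal` is the space of extended-valued random variables. -/

section EssentialInfimum

variable {Ω : Type u} [MeasurableSpace Ω] (P : Measure Ω)

/-- The a.s. order on extended-valued random variables is order complete from below:
every family has an essential infimum, i.e. a greatest lower bound for the a.s. order. -/
theorem exists_essInf [IsFiniteMeasure P] (S : Set (Ω →ₘ[P] EReal)) :
    ∃ a : Ω →ₘ[P] EReal, IsGLB S a := by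
  rcases S.eq_empty_or_nonempty with rfl | hne
  · refine ⟨AEEqFun.const Ω ⊤, ?_⟩
    refine ⟨by simp, fun b _ => ?_⟩
    rw [← AEEqFun.coeFn_le]
    filter_upwards [AEEqFun.coeFn_const (μ := P) Ω (⊤ : EReal)] with ω h
    rw [h]
    exact le_top
  have : Nonempty S := hne.to_subtype
  let g : EReal ≃o Set.Icc (0 : ℝ) 1 :=
    EReal.expOrderIso.trans ENNReal.orderIsoUnitIntervalBirational
  have hg : Measurable fun x : EReal => (g x : ℝ) :=
    (continuous_subtype_val.comp g.continuous).measurable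
  have hmono : ∀ {x y : EReal}, x ≤ y → (g x : ℝ) ≤ g y := fun h => g.monotone h
  have hinj : ∀ {x y : EReal}, (g x : ℝ) = g y → x = y := fun h => g.injective (Subtype.ext h)
  let F : (ℕ → S) → Ω → EReal := fun s ω => ⨅ n, (s n : Ω →ₘ[P] EReal) ω
  have hFm : ∀ s, Measurable (F s) := fun s =>
    Measurable.iInf fun n => (s n : Ω →ₘ[P] EReal).measurable
  have hint : ∀ s, Integrable (fun ω => (g (F s ω) : ℝ)) P := fun s =>
    Integrable.of_bound (hg.comp (hFm s)).aestronglyMeasurable 1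
      (Eventually.of_forall fun ω => by
        rw [Real.norm_eq_abs, abs_le]
        have h := (g (F s ω)).2
        exact ⟨by linarith [h.1], h.2⟩)
  let I : (ℕ → S) → ℝ := fun s => ∫ ω, (g (F s ω) : ℝ) ∂P
  have hbdd : BddBelow (Set.range I) := ⟨0, by
    rintro _ ⟨s, rfl⟩
    exact integral_nonneg fun ω => (g (F s ω)).2.1⟩
  have hmin : ∃ s, ∀ t, I s ≤ I t := by
    have hk : ∀ k : ℕ, ∃ s, I s < (⨅ t, I t) + 1 / ((k : ℝ) + 1) := fun k =>
      exists_lt_of_ciInf_lt (lt_add_of_pos_right _ (by positivity))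
    choose s hs using hk
    refine ⟨fun n => s n.unpair.1 n.unpair.2, fun t => ?_⟩
    have hle : ∀ k, I (fun n => s n.unpair.1 n.unpair.2) ≤ I (s k) := fun k =>
      integral_mono (hint _) (hint _) fun ω => hmono (le_iInf fun m => by
        refine (iInf_le _ (Nat.pair k m)).trans ?_
        simp)
    refine le_trans ?_ (ciInf_le hbdd t)
    refine ge_of_tendsto' (x := atTop)
      (f := fun k : ℕ => (⨅ t, I t) + 1 / ((k : ℝ) + 1)) ?_ fun k => (hle k).trans (hs k).le
    simpa using tendsto_const_nhds.add (tendsto_one_div_add_atTop_nhds_zero_nat (𝕜 := ℝ))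
  obtain ⟨s, hs⟩ := hmin
  refine ⟨AEEqFun.mk (F s) (hFm s).aestronglyMeasurable, ?_, ?_⟩
  · intro t ht
    let s' : ℕ → S := fun n => Nat.casesOn n ⟨t, ht⟩ s
    have hF : ∀ ω, F s' ω ≤ F s ω := fun ω => le_iInf fun n => iInf_le _ (n + 1)
    have hF0 : ∀ ω, F s' ω ≤ t ω := fun ω => by
      have h : F s' ω ≤ (s' 0 : Ω →ₘ[P] EReal) ω := iInf_le _ 0
      exact h
    have heq : (fun ω => (g (F s' ω) : ℝ)) =ᵐ[P] fun ω => (g (F s ω) : ℝ) :=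
      (integral_eq_iff_of_ae_le (hint _) (hint _)
        (Eventually.of_forall fun ω => hmono (hF ω))).1
        (le_antisymm (integral_mono (hint _) (hint _) fun ω => hmono (hF ω)) (hs s'))
    rw [← AEEqFun.coeFn_le]
    filter_upwards [AEEqFun.coeFn_mk (F s) (hFm s).aestronglyMeasurable, heq] with ω h1 h2
    rw [h1, ← hinj h2]
    exact hF0 ω
  · intro b hb
    rw [← AEEqFun.coeFn_le]
    have hall : ∀ᵐ ω ∂P, ∀ n, b ω ≤ (s n : Ω →ₘ[P] EReal) ω :=
      ae_all_iff.2 fun n => AEEqFun.coeFn_le.2 (hb (s n).2)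
    filter_upwards [AEEqFun.coeFn_mk (F s) (hFm s).aestronglyMeasurable, hall] with ω h1 h2
    rw [h1]
    exact le_iInf h2

/-- The essential infimum of a family of extended-valued random variables. -/
noncomputable def essInfFamily [IsFiniteMeasure P] (S : Set (Ω →ₘ[P] EReal)) :
    Ω →ₘ[P] EReal :=
  (exists_essInf P S).choose

theorem isGLB_essInfFamily [IsFiniteMeasure P] (S : Set (Ω →ₘ[P] EReal)) :
    IsGLB S (essInfFamily P S) :=
  (exists_essInf P S).choose_spec

/-- A finite random variable regarded as an extended-valued one. -/
noncomputable def toExt {P : Measure Ω} (X : Ω →ₘ[P] ℝ) : Ω →ₘ[P] EReal :=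
  AEEqFun.comp (fun x : ℝ => (x : EReal)) continuous_coe_real_ereal X

end EssentialInfimum

section Spaces

variable {Ω : Type u} (G : MeasurableSpace Ω) {mΩ : MeasurableSpace Ω} {P : Measure Ω}

/-- `X 𝟏_A` as a random variable. -/
noncomputable def restr (X : Ω →ₘ[P] ℝ) (A : Set Ω) (hA : MeasurableSet A) : Ω →ₘ[P] ℝ :=
  AEEqFun.mk (A.indicator X) (X.aestronglyMeasurable.indicator hA)

/-- The vector space `L` is closed under the lattice operations of `L⁰`. -/
def IsVectorLattice (L : Submodule ℝ (Ω →ₘ[P] ℝ)) : Prop :=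
  ∀ X ∈ L, ∀ Y ∈ L, X ⊔ Y ∈ L ∧ X ⊓ Y ∈ L

/-- Property `1_G` for a σ-algebra `G ⊆ F`: `X 𝟏_A ∈ L` for all `X ∈ L`, `A ∈ G`. -/
def HasIndicators (hG : G ≤ mΩ) (L : Submodule ℝ (Ω →ₘ[P] ℝ)) : Prop :=
  ∀ X ∈ L, ∀ (A : Set Ω) (hA : MeasurableSet[G] A), restr X A (hG A hA) ∈ L

/-- Order convergence in `L` of a net: `|x i - a| ≤ y i` for some net `y ↓ 0` in `L`.
The infimum of `y` is taken in `L`. -/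
def OrderTendsto (L : Submodule ℝ (Ω →ₘ[P] ℝ)) {ι : Type u} [Preorder ι]
    (x : ι → L) (a : L) : Prop :=
  ∃ y : ι → L, Antitone y ∧ IsGLB (Set.range y) 0 ∧
    ∀ i, |(x i : Ω →ₘ[P] ℝ) - (a : Ω →ₘ[P] ℝ)| ≤ (y i : Ω →ₘ[P] ℝ)

/-- The order continuous dual of `L`: linear functionals that map order convergent nets to
convergent nets. (Index sets in the universe of `Ω` suffice, since the pairs of elements of `L`
live there.) -/
def orderDual (L : Submodule ℝ (Ω →ₘ[P] ℝ)) : Submodule ℝ (L →ₗ[ℝ] ℝ) where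
  carrier := {φ | ∀ (ι : Type u) [Preorder ι] [IsDirectedOrder ι] [Nonempty ι]
    (x : ι → L) (a : L), OrderTendsto L x a → Tendsto (fun i => φ (x i)) atTop (𝓝 (φ a))}
  add_mem' hφ hψ ι _ _ _ x a h := by
    simpa using (hφ ι x a h).add (hψ ι x a h)
  zero_mem' ι _ _ _ x a _ := by simp
  smul_mem' c φ hφ ι _ _ _ x a h := by
    simpa using (hφ ι x a h).const_mul c

/-- `Z ∈ L¹` represents the functional `φ` on `L`: `φ X = E[Z X]` for all `X ∈ L`. -/
def Represents {L : Submodule ℝ (Ω →ₘ[P] ℝ)} (Z : Ω → ℝ) (φ : L →ₗ[ℝ] ℝ) : Prop :=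
  Integrable Z P ∧ ∀ X : L, Integrable (fun ω => Z ω * (X : Ω →ₘ[P] ℝ) ω) P ∧
    φ X = ∫ ω, Z ω * (X : Ω →ₘ[P] ℝ) ω ∂P

/-- The order continuous dual of `L` is contained in `L¹`. -/
def DualInL1 (L : Submodule ℝ (Ω →ₘ[P] ℝ)) : Prop :=
  ∀ φ ∈ orderDual L, ∃ Z : Ω → ℝ, Represents Z φ

/-- The order continuous dual of `L` separates the points of `L`. -/
def DualSeparates (L : Submodule ℝ (Ω →ₘ[P] ℝ)) : Prop :=
  ∀ X : L, X ≠ 0 → ∃ φ ∈ orderDual L, φ X ≠ 0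

/-- The weak topology `σ(L, L*)`: the coarsest topology for which all elements of the order
continuous dual are continuous. -/
@[reducible]
def weakTopology (L : Submodule ℝ (Ω →ₘ[P] ℝ)) : TopologicalSpace L :=
  TopologicalSpace.induced (fun X (φ : orderDual L) => (φ : L →ₗ[ℝ] ℝ) X) inferInstance

/-- `L* ∩ 𝒫`: the probability measures `Q ≪ P` whose density `dQ/dP` represents an element of the
order continuous dual of `L`. -/
def dualProbabilities (L : Submodule ℝ (Ω →ₘ[P] ℝ)) : Set (Measure Ω) :=
  {Q | IsProbabilityMeasure Q ∧ Q ≪ P ∧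
    ∃ φ ∈ orderDual L, Represents (fun ω => (Q.rnDeriv P ω).toReal) φ}

end Spaces

section Maps

variable {Ω : Type u} (G : MeasurableSpace Ω) {mΩ : MeasurableSpace Ω} {P : Measure Ω}
  {LF LG : Submodule ℝ (Ω →ₘ[P] ℝ)}

/-- (QCO): `π (Λ X + (1 - Λ) Y) ≤ π X ∨ π Y` for every `G`-measurable `Λ` with `0 ≤ Λ ≤ 1`,
whenever the combination `W = Λ X + (1 - Λ) Y` lies in the domain of `π`. -/
def CondQuasiconvex (π : LF → LG) : Prop :=
  ∀ (X Y W : LF) (Λ : Ω →ₘ[P] ℝ), AEStronglyMeasurable[G] Λ P → 0 ≤ Λ → Λ ≤ 1 →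
    (W : Ω →ₘ[P] ℝ) = Λ * (X : Ω →ₘ[P] ℝ) + (1 - Λ) * (Y : Ω →ₘ[P] ℝ) →
    (π W : Ω →ₘ[P] ℝ) ≤ (π X : Ω →ₘ[P] ℝ) ⊔ (π Y : Ω →ₘ[P] ℝ)

/-- (REG): `π (X 𝟏_A + Y 𝟏_{Aᶜ}) = π X 𝟏_A + π Y 𝟏_{Aᶜ}` for every `A ∈ G`. -/
def Regular (hG : G ≤ mΩ) (π : LF → LG) : Prop :=
  ∀ (X Y W : LF) (A : Set Ω) (hA : MeasurableSet[G] A),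
    (W : Ω →ₘ[P] ℝ) = restr (X : Ω →ₘ[P] ℝ) A (hG A hA)
      + restr (Y : Ω →ₘ[P] ℝ) Aᶜ (hG A hA).compl →
    (π W : Ω →ₘ[P] ℝ) = restr (π X : Ω →ₘ[P] ℝ) A (hG A hA)
      + restr (π Y : Ω →ₘ[P] ℝ) Aᶜ (hG A hA).compl

/-- (LSC) for `σ(LF, LF*)`: all lower level sets `{X | π X ≤ Y}`, `Y ∈ LG`, are closed. -/
def WeaklyLSC (π : LF → LG) : Prop :=
  ∀ Y : LG, IsClosed[weakTopology LF] {X : LF | π X ≤ Y}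

/-- `K(X, Q)`, the essential infimum of `π ξ` over all `ξ ∈ LF` with
`E_Q[ξ|G] ≥ E_Q[X|G]` `Q`-almost surely. -/
noncomputable def K [IsFiniteMeasure P] (π : LF → LG) (X : LF)
    (Q : Measure Ω) : Ω →ₘ[P] EReal :=
  essInfFamily P {Y | ∃ ξ : LF,
    Q[((X : Ω →ₘ[P] ℝ) : Ω → ℝ) | G] ≤ᵐ[Q] Q[((ξ : Ω →ₘ[P] ℝ) : Ω → ℝ) | G] ∧
    Y = toExt (π ξ : Ω →ₘ[P] ℝ)}

end Maps

end QuasiconvexDual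

/-! Each `K(X, Q)` is at most `π X`, since `X` itself competes. Conversely, let `S` bound all `K(X,
Q)` from above, and let `U ∈ LG` be positive on `A ∈ G`. If some `ξ₁` has `π ξ₁ ≤ π X - U` on `A`,
lower `π X` by `U` on `A` only and let `C` be the resulting sublevel set of `π`. It is convex and
weakly closed and misses `X`, so Hahn-Banach gives an order continuous `φ` and `r` with `φ < r < φ
X` on `C`. Monotonicity of `π` makes `φ` positive, hence given by a density `Z ≥ 0`.

This scalar separation must become conditional on `G`. By (REG), `C` is stable under gluing along
`G`; if members of `C` could match `X` conditionally on sets exhausting `A`, gluing them would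
violate the gap at `r`. Thus `exists_set_forall_setIntegral_pos` finds a non-null `D ∈ G` with
strict separation on every non-null `G`-part. Normalizing `Z 𝟏_D` gives `Q`, and every competitor in
`K(X, Q)` has `π ξ ≥ π X - U` on `D` (`exists_dualProbability_forall_le`). Exhaustion spreads `π X -
U ≤ S` over `A`; then `U` is scaled to zero. -/

namespace QuasiconvexDual

/-! ### Exhaustion by measurable sets. -/

section Exhaustion

variable {Ω : Type u} {mΩ : MeasurableSpace Ω} {P : Measure Ω}

/-- A nonempty family of sets that is stable under finite unions is exhausted, up to null sets, by
an increasing sequence of its members. -/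
theorem exists_monotone_exhausting [IsFiniteMeasure P] (𝒟 : Set (Set Ω)) (hne : 𝒟.Nonempty)
    (hunion : ∀ D ∈ 𝒟, ∀ E ∈ 𝒟, D ∪ E ∈ 𝒟) (hmeas : ∀ D ∈ 𝒟, MeasurableSet D) :
    ∃ s : ℕ → Set Ω, Monotone s ∧ (∀ n, s n ∈ 𝒟) ∧ ∀ E ∈ 𝒟, P (E \ ⋃ n, s n) = 0 := by
  obtain ⟨v, -, hvt, hv⟩ := exists_seq_tendsto_sSup (hne.image P) (OrderTop.bddAbove _)
  choose t ht htv using hv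
  have hs : ∀ n, Set.accumulate t n ∈ 𝒟 := by
    intro n
    induction n with
    | zero => simpa using ht 0
    | succ n ih =>
      rw [Set.accumulate_succ]
      exact hunion _ ih _ (ht _)
  refine ⟨Set.accumulate t, Set.monotone_accumulate, hs, fun E hE => ?_⟩
  have hUm : MeasurableSet (⋃ n, Set.accumulate t n) :=
    MeasurableSet.iUnion fun n => hmeas _ (hs n)
  -- The union attains the supremum of the measures over the family, and adjoining `E` cannot exceed
  -- it, so `E` adds only a null set.
  have h1 : sSup (P '' 𝒟) ≤ P (⋃ n, Set.accumulate t n) := by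
    refine le_of_tendsto' hvt fun n => ?_
    rw [← htv n]
    exact measure_mono
      ((Set.subset_accumulate (s := t) (x := n)).trans (Set.subset_iUnion _ n))
  have h2 : P (E ∪ ⋃ n, Set.accumulate t n) ≤ sSup (P '' 𝒟) := by
    rw [Set.union_iUnion]
    refine le_of_tendsto' (tendsto_measure_iUnion_atTop ?_) fun n =>
      le_sSup ⟨_, hunion _ hE _ (hs n), rfl⟩
    exact fun i j hij => Set.union_subset_union_right _ (Set.monotone_accumulate hij)
  have h3 := measure_sdiff (μ := P) (Set.subset_union_right (s := E)) hUm.nullMeasurableSet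
    (measure_ne_top _ _)
  rw [Set.union_sdiff_right] at h3
  rw [h3]
  exact tsub_eq_zero_of_le (h2.trans h1)

/-- A property that holds on a non-null part of every non-null subset of `A` holds almost
everywhere on `A`. -/
theorem ae_mem_imp_of_forall_exists_subset [IsFiniteMeasure P] {G : MeasurableSpace Ω}
    (hG : G ≤ mΩ) {p : Ω → Prop} {A : Set Ω} (hA : MeasurableSet[G] A)
    (h : ∀ B ⊆ A, MeasurableSet[G] B → P B ≠ 0 →
      ∃ D ⊆ B, MeasurableSet[G] D ∧ P D ≠ 0 ∧ ∀ᵐ ω ∂P, ω ∈ D → p ω) :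
    ∀ᵐ ω ∂P, ω ∈ A → p ω := by
  obtain ⟨s, -, hs, hmax⟩ := exists_monotone_exhausting (P := P)
    {D | MeasurableSet[G] D ∧ ∀ᵐ ω ∂P, ω ∈ D → p ω} ⟨∅, by simp⟩
    (by
      rintro D ⟨hD, hD'⟩ E ⟨hE, hE'⟩
      refine ⟨hD.union hE, ?_⟩
      filter_upwards [hD', hE'] with ω h1 h2 h3
      exact h3.elim h1 h2)
    fun D hD => hG _ hD.1
  have hU : MeasurableSet[G] (⋃ n, s n) := MeasurableSet.iUnion fun n => (hs n).1
  have h0 : P (A \ ⋃ n, s n) = 0 := by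
    by_contra h0
    obtain ⟨D, hDA, hDm, hD0, hD⟩ := h _ Set.sdiff_subset (hA.diff hU) h0
    refine hD0 (measure_mono_null (fun ω hω => ?_) (hmax D ⟨hDm, hD⟩))
    exact ⟨hω, (hDA hω).2⟩
  filter_upwards [measure_eq_zero_iff_ae_notMem.1 h0, ae_all_iff.2 fun n => (hs n).2]
    with ω h1 h2 hω
  by_cases hmem : ω ∈ ⋃ n, s n
  · obtain ⟨n, hn⟩ := Set.mem_iUnion.1 hmem
    exact h2 n hn
  · exact absurd ⟨hω, hmem⟩ h1

end Exhaustion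

/-! ### Multiplication by indicators, and normalization of densities. -/

section Cut

variable {Ω : Type u} {mΩ : MeasurableSpace Ω} {P : Measure Ω}

theorem coeFn_restr (X : Ω →ₘ[P] ℝ) (A : Set Ω) (hA : MeasurableSet A) :
    restr X A hA =ᵐ[P] A.indicator X :=
  AEEqFun.coeFn_mk _ _

/-- Multiplication by the indicator of `A` on a space with property `1_F`. -/
noncomputable def cut {L : Submodule ℝ (Ω →ₘ[P] ℝ)} (h1 : HasIndicators mΩ le_rfl L) (A : Set Ω)
    (hA : MeasurableSet A) : L →ₗ[ℝ] L where
  toFun X := ⟨restr X A hA, h1 X X.2 A hA⟩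
  map_add' X Y := by
    refine Subtype.ext (AEEqFun.ext ?_)
    simp only [Submodule.coe_add]
    filter_upwards [coeFn_restr (X + Y : Ω →ₘ[P] ℝ) A hA, coeFn_restr (X : Ω →ₘ[P] ℝ) A hA,
      coeFn_restr (Y : Ω →ₘ[P] ℝ) A hA, AEEqFun.coeFn_add (X : Ω →ₘ[P] ℝ) (Y : Ω →ₘ[P] ℝ),
      AEEqFun.coeFn_add (restr (X : Ω →ₘ[P] ℝ) A hA) (restr (Y : Ω →ₘ[P] ℝ) A hA)]
      with ω h1 h2 h3 h4 h5
    by_cases hω : ω ∈ A <;> simp [h1, h2, h3, h4, h5, hω]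
  map_smul' c X := by
    refine Subtype.ext (AEEqFun.ext ?_)
    simp only [Submodule.coe_smul, RingHom.id_apply]
    filter_upwards [coeFn_restr (c • X : Ω →ₘ[P] ℝ) A hA, coeFn_restr (X : Ω →ₘ[P] ℝ) A hA,
      AEEqFun.coeFn_smul c (X : Ω →ₘ[P] ℝ),
      AEEqFun.coeFn_smul c (restr (X : Ω →ₘ[P] ℝ) A hA)] with ω h1 h2 h3 h4
    by_cases hω : ω ∈ A <;> simp [h1, h2, h3, h4, hω]

variable {L : Submodule ℝ (Ω →ₘ[P] ℝ)} (h1 : HasIndicators mΩ le_rfl L)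

theorem coeFn_cut (A : Set Ω) (hA : MeasurableSet A) (X : L) :
    ((cut h1 A hA X : L) : Ω →ₘ[P] ℝ) =ᵐ[P] A.indicator (X : Ω →ₘ[P] ℝ) :=
  coeFn_restr _ _ hA

/-- Cutting only shrinks `|x i - a|`, so the same net `y ↓ 0` still dominates. -/
theorem comp_cut_mem_orderDual (A : Set Ω) (hA : MeasurableSet A) {φ : L →ₗ[ℝ] ℝ}
    (hφ : φ ∈ orderDual L) : φ ∘ₗ cut h1 A hA ∈ orderDual L := by
  intro ι _ _ _ x a ⟨y, hy, hy0, hxy⟩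
  refine hφ ι _ _ ⟨y, hy, hy0, fun i => le_trans ?_ (hxy i)⟩
  rw [← AEEqFun.coeFn_le]
  filter_upwards [coeFn_cut h1 A hA (x i), coeFn_cut h1 A hA a,
    AEEqFun.coeFn_abs ((x i : Ω →ₘ[P] ℝ) - (a : Ω →ₘ[P] ℝ)),
    AEEqFun.coeFn_abs (((cut h1 A hA (x i) : L) : Ω →ₘ[P] ℝ) - ((cut h1 A hA a : L) : Ω →ₘ[P] ℝ)),
    AEEqFun.coeFn_sub (x i : Ω →ₘ[P] ℝ) a,
    AEEqFun.coeFn_sub ((cut h1 A hA (x i) : L) : Ω →ₘ[P] ℝ) (cut h1 A hA a : L)]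
    with ω h1 h2 h3 h4 h5 h6
  rw [h3, h4, h5, h6]
  by_cases hω : ω ∈ A <;> simp [h1, h2, hω]

theorem Represents.cut {Z : Ω → ℝ} {φ : L →ₗ[ℝ] ℝ} (hZ : Represents Z φ) (A : Set Ω)
    (hA : MeasurableSet A) : Represents (A.indicator Z) (φ ∘ₗ cut h1 A hA) := by
  refine ⟨hZ.1.indicator hA, fun X => ?_⟩
  have hX := hZ.2 (QuasiconvexDual.cut h1 A hA X)
  have hae : (fun ω => Z ω * ((QuasiconvexDual.cut h1 A hA X : L) : Ω →ₘ[P] ℝ) ω) =ᵐ[P]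
      fun ω => A.indicator Z ω * (X : Ω →ₘ[P] ℝ) ω := by
    filter_upwards [coeFn_cut h1 A hA X] with ω h
    by_cases hω : ω ∈ A <;> simp [h, hω]
  exact ⟨hX.1.congr hae, by rw [LinearMap.comp_apply, hX.2, integral_congr_ae hae]⟩

theorem Represents.congr {Z Z' : Ω → ℝ} {φ : L →ₗ[ℝ] ℝ} (hZ : Represents Z φ)
    (h : Z =ᵐ[P] Z') : Represents Z' φ := by
  refine ⟨hZ.1.congr h, fun X => ?_⟩
  have hae : (fun ω => Z ω * (X : Ω →ₘ[P] ℝ) ω) =ᵐ[P] fun ω => Z' ω * (X : Ω →ₘ[P] ℝ) ω := by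
    filter_upwards [h] with ω h
    rw [h]
  exact ⟨(hZ.2 X).1.congr hae, by rw [(hZ.2 X).2, integral_congr_ae hae]⟩

theorem Represents.smul {Z : Ω → ℝ} {φ : L →ₗ[ℝ] ℝ} (hZ : Represents Z φ) (c : ℝ) :
    Represents (fun ω => c * Z ω) (c • φ) := by
  refine ⟨hZ.1.const_mul c, fun X => ?_⟩
  simp only [mul_assoc, LinearMap.smul_apply, smul_eq_mul]
  exact ⟨(hZ.2 X).1.const_mul c, by rw [(hZ.2 X).2, integral_const_mul]⟩

/-- A nonnegative density of an order continuous functional yields, after normalization, an element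
of `L* ∩ 𝒫`. -/
theorem exists_dualProbability [IsFiniteMeasure P] {Z : Ω → ℝ} {φ : L →ₗ[ℝ] ℝ}
    (hφ : φ ∈ orderDual L)
    (hZ : Represents Z φ) (hpos : 0 ≤ᵐ[P] Z) (hint : 0 < ∫ ω, Z ω ∂P) :
    ∃ Q ∈ dualProbabilities L, ∃ c > 0, ∀ X : L, Integrable (X : Ω →ₘ[P] ℝ) Q ∧
      ∀ E, MeasurableSet E →
        ∫ ω in E, (X : Ω →ₘ[P] ℝ) ω ∂Q = c * ∫ ω in E, Z ω * (X : Ω →ₘ[P] ℝ) ω ∂P := by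
  set c := (∫ ω, Z ω ∂P)⁻¹ with hc
  have hc0 : 0 < c := inv_pos.2 hint
  have hW := hZ.smul c
  have hWpos : ∀ᵐ ω ∂P, 0 ≤ c * Z ω := by
    filter_upwards [hpos] with ω h
    exact mul_nonneg hc0.le h
  obtain ⟨W, hWm, hWe⟩ : ∃ W : Ω → NNReal, Measurable W ∧
      (fun ω => c * Z ω) =ᵐ[P] fun ω => W ω := by
    refine ⟨fun ω => (hW.1.aestronglyMeasurable.mk _ ω).toNNReal,
      hW.1.aestronglyMeasurable.stronglyMeasurable_mk.measurable.real_toNNReal, ?_⟩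
    filter_upwards [hW.1.aestronglyMeasurable.ae_eq_mk, hWpos] with ω h1 h2
    rw [← h1, Real.coe_toNNReal _ h2]
  have hWR := hW.congr hWe
  let Q := P.withDensity fun ω => (W ω : ENNReal)
  have hQP : Q ≪ P := withDensity_absolutelyContinuous _ _
  have hQ1 : IsProbabilityMeasure Q := by
    refine ⟨?_⟩
    rw [withDensity_apply _ MeasurableSet.univ, Measure.restrict_univ, lintegral_coe_eq_integral _ hWR.1, ← integral_congr_ae hWe, integral_const_mul, hc,
      inv_mul_cancel₀ hint.ne', ENNReal.ofReal_one]
  have hrn : (fun ω => (W ω : ℝ)) =ᵐ[P] fun ω => (Q.rnDeriv P ω).toReal := by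
    filter_upwards [Measure.rnDeriv_withDensity P hWm.coe_nnreal_ennreal] with ω h
    rw [h, ENNReal.coe_toReal]
  refine ⟨Q, ⟨hQ1, hQP, c • φ, Submodule.smul_mem _ _ hφ, hWR.congr hrn⟩, c, hc0, fun X => ⟨?_, ?_⟩⟩
  · refine (integrable_withDensity_iff_integrable_smul hWm).2 ?_
    simpa only [NNReal.smul_def, smul_eq_mul] using (hWR.2 X).1
  · intro E hE
    rw [setIntegral_withDensity_eq_setIntegral_smul hWm _ hE, ← integral_const_mul]
    refine integral_congr_ae (ae_restrict_of_ae ?_)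
    filter_upwards [hWe] with ω h
    rw [NNReal.smul_def, smul_eq_mul, ← h, mul_assoc]

end Cut

/-! ### Hahn-Banach separation and positivity of the density. -/

section Separation

variable {Ω : Type u} {mΩ : MeasurableSpace Ω} {P : Measure Ω} {L : Submodule ℝ (Ω →ₘ[P] ℝ)}

/-- A weakly closed convex set and a point outside are strictly separated by an order continuous
functional. -/
theorem exists_orderDual_separating {C : Set L} (hconv : Convex ℝ C)
    (hclosed : IsClosed[weakTopology L] C) {x : L} (hx : x ∉ C) :
    ∃ φ ∈ orderDual L, ∃ r : ℝ, (∀ a ∈ C, φ a < r) ∧ r < φ x := by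
  let T : L →ₗ[ℝ] (orderDual L → ℝ) := LinearMap.pi fun φ => (φ : L →ₗ[ℝ] ℝ)
  let _ : TopologicalSpace L := weakTopology L
  have : IsTopologicalAddGroup L := topologicalAddGroup_induced T
  have : ContinuousSMul ℝ L := continuousSMul_induced T
  have : LocallyConvexSpace ℝ L := LocallyConvexSpace.induced T
  obtain ⟨f, r, hf, hr⟩ := geometric_hahn_banach_closed_point hconv hclosed hx
  -- Order convergence implies weak convergence, so a weakly continuous functional is order
  -- continuous; the weak dual need not be identified.
  refine ⟨f.toLinearMap, fun ι _ _ _ y a hya => ?_, r, hf, hr⟩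
  refine (f.continuous.tendsto a).comp ?_
  rw [nhds_induced, tendsto_comap_iff, tendsto_pi_nhds]
  exact fun φ => φ.2 ι y a hya

/-- A positive order continuous functional with a density has a nonnegative density. -/
theorem exists_nonneg_represents (h1 : HasIndicators mΩ le_rfl L) (hL : IsVectorLattice L)
    {φ : L →ₗ[ℝ] ℝ} (hpos : ∀ η : L, 0 ≤ η → 0 ≤ φ η) {Z : Ω → ℝ} (hZ : Represents Z φ) :
    ∃ Z' : Ω → ℝ, 0 ≤ Z' ∧ Represents Z' φ := by
  obtain ⟨W, hWm, hWe⟩ := hZ.1.aestronglyMeasurable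
  have hW := hZ.congr hWe
  refine ⟨fun ω => max (W ω) 0, fun ω => le_max_right _ _, ?_⟩
  let N : Set Ω := {ω | W ω < 0}
  have hN : MeasurableSet N := hWm.measurable measurableSet_Iio
  -- Test `φ` on `|X| 𝟏_N`: the value is nonnegative but the integrand is nonpositive, so `W X = 0`
  -- on `N`. Only products are compared, since `W` may be negative where all of `L` vanishes.
  have key : ∀ X : L, (fun ω => W ω * (X : Ω →ₘ[P] ℝ) ω) =ᵐ[P]
      fun ω => max (W ω) 0 * (X : Ω →ₘ[P] ℝ) ω := by
    intro X
    have hneg : -(X : Ω →ₘ[P] ℝ) ∈ L := L.neg_mem X.2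
    let η : L := ⟨(X : Ω →ₘ[P] ℝ) ⊔ -X, (hL _ X.2 _ hneg).1⟩
    have hη : ∀ᵐ ω ∂P, (η : Ω →ₘ[P] ℝ) ω = |(X : Ω →ₘ[P] ℝ) ω| := by
      filter_upwards [AEEqFun.coeFn_sup (X : Ω →ₘ[P] ℝ) (-X), AEEqFun.coeFn_neg (X : Ω →ₘ[P] ℝ)]
        with ω h2 h3
      rw [h2, h3]
      rfl
    have hη0 : (0 : L) ≤ cut h1 N hN η := by
      change (0 : Ω →ₘ[P] ℝ) ≤ (cut h1 N hN η : L)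
      rw [← AEEqFun.coeFn_le]
      filter_upwards [coeFn_cut h1 N hN η, hη, AEEqFun.coeFn_zero (α := Ω) (β := ℝ) (μ := P)]
        with ω h2 h3 h4
      rw [h4, h2]
      by_cases hω : ω ∈ N <;> simp [hω, h3]
    have h0 := hpos _ hη0
    have hrep := (hW.cut h1 N hN).2 η
    rw [← LinearMap.comp_apply, hrep.2] at h0
    have hle : (fun ω => N.indicator W ω * (η : Ω →ₘ[P] ℝ) ω) ≤ᵐ[P] 0 := by
      filter_upwards [hη] with ω h
      by_cases hω : ω ∈ N
      · simpa [hω, h] using mul_nonpos_of_nonpos_of_nonneg (le_of_lt hω) (abs_nonneg _)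
      · simp [hω]
    have hz : (fun ω => N.indicator W ω * (η : Ω →ₘ[P] ℝ) ω) =ᵐ[P] 0 :=
      (integral_eq_iff_of_ae_le hrep.1 (integrable_zero _ _ _) hle).1
        (le_antisymm (integral_mono_ae hrep.1 (integrable_zero _ _ _) hle) (by simpa using h0))
    filter_upwards [hz, hη] with ω h2 h3
    by_cases hω : ω ∈ N
    · have hω' : W ω < 0 := hω
      simp only [Set.indicator_of_mem hω, h3, Pi.zero_apply, mul_eq_zero, hω'.ne, false_or,
        abs_eq_zero] at h2
      simp [h2]
    · rw [max_eq_left (not_lt.1 hω)]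
  exact ⟨hW.1.pos_part, fun X => ⟨(hW.2 X).1.congr (key X), by
    rw [(hW.2 X).2, integral_congr_ae (key X)]⟩⟩

end Separation

/-! ### Gluing along measurable sets. -/

section Glue

variable {Ω : Type u} {G : MeasurableSpace Ω} {mΩ : MeasurableSpace Ω} {P : Measure Ω}
  {LF LG : Submodule ℝ (Ω →ₘ[P] ℝ)} (h1F : HasIndicators mΩ le_rfl LF)

/-- The random variable `ξ 𝟏_E + η 𝟏_{Eᶜ}`. -/
noncomputable def glue (E : Set Ω) (hE : MeasurableSet E) (ξ η : LF) : LF :=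
  cut h1F E hE ξ + cut h1F Eᶜ hE.compl η

theorem restr_add_restr_compl (X Y : Ω →ₘ[P] ℝ) (E : Set Ω) (hE : MeasurableSet E) :
    ∀ᵐ ω ∂P, (ω ∈ E → (restr X E hE + restr Y Eᶜ hE.compl) ω = X ω) ∧
      (ω ∉ E → (restr X E hE + restr Y Eᶜ hE.compl) ω = Y ω) := by
  filter_upwards [AEEqFun.coeFn_add (restr X E hE) (restr Y Eᶜ hE.compl), coeFn_restr X E hE,
    coeFn_restr Y Eᶜ hE.compl] with ω h1 h2 h3
  rw [h1, Pi.add_apply, h2, h3]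
  constructor <;> intro h <;> simp [h]

theorem coeFn_glue (E : Set Ω) (hE : MeasurableSet E) (ξ η : LF) :
    ∀ᵐ ω ∂P, (ω ∈ E → ((glue h1F E hE ξ η : LF) : Ω →ₘ[P] ℝ) ω = (ξ : Ω →ₘ[P] ℝ) ω) ∧
      (ω ∉ E → ((glue h1F E hE ξ η : LF) : Ω →ₘ[P] ℝ) ω = (η : Ω →ₘ[P] ℝ) ω) :=
  restr_add_restr_compl _ _ E hE

theorem Regular.coeFn_glue {hG : G ≤ mΩ} {π : LF → LG} (hreg : Regular G hG π) (E : Set Ω)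
    (hE : MeasurableSet[G] E) (ξ η : LF) :
    ∀ᵐ ω ∂P, (ω ∈ E → (π (glue h1F E (hG _ hE) ξ η) : Ω →ₘ[P] ℝ) ω = (π ξ : Ω →ₘ[P] ℝ) ω) ∧
      (ω ∉ E → (π (glue h1F E (hG _ hE) ξ η) : Ω →ₘ[P] ℝ) ω = (π η : Ω →ₘ[P] ℝ) ω) := by
  rw [hreg ξ η (glue h1F E (hG _ hE) ξ η) E hE rfl]
  exact restr_add_restr_compl _ _ E (hG _ hE)

end Glue

/-! ### From scalar to conditional separation. -/

section Localization

variable {Ω : Type u} {G : MeasurableSpace Ω} {mΩ : MeasurableSpace Ω} {P : Measure Ω}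
  {LF LG : Submodule ℝ (Ω →ₘ[P] ℝ)}

/-- An integrable function with nonpositive integral over a non-null set `E ∈ G` has nonpositive
integrals over all `G`-measurable subsets of some non-null `E' ⊆ E`, `E' ∈ G`. -/
theorem exists_subset_forall_setIntegral_nonpos [IsFiniteMeasure P] (hG : G ≤ mΩ) {h : Ω → ℝ}
    (hint : Integrable h P) {E : Set Ω} (hE : MeasurableSet[G] E) (hE0 : P E ≠ 0)
    (hle : ∫ ω in E, h ω ∂P ≤ 0) :
    ∃ E' ⊆ E, MeasurableSet[G] E' ∧ P E' ≠ 0 ∧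
      ∀ B ⊆ E', MeasurableSet[G] B → ∫ ω in B, h ω ∂P ≤ 0 := by
  have hm : Measurable[G] (P[h | G]) := stronglyMeasurable_condExp.measurable
  have hg : MeasurableSet[G] {ω | P[h | G] ω ≤ 0} := hm measurableSet_Iic
  -- If this set were null, the conditional expectation would be positive a.e. on `E`, making the
  -- integral over `E` positive.
  refine ⟨E ∩ {ω | P[h | G] ω ≤ 0}, Set.inter_subset_left, hE.inter hg, fun h0 => ?_,
    fun B hB hBm => ?_⟩
  · have hpos : ∀ᵐ ω ∂P, ω ∈ E → 0 < P[h | G] ω := by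
      filter_upwards [measure_eq_zero_iff_ae_notMem.1 h0] with ω h1 h2
      exact not_le.1 fun h3 => h1 ⟨h2, h3⟩
    rw [← setIntegral_condExp hG hint hE] at hle
    refine hle.not_gt ((setIntegral_pos_iff_support_of_nonneg_ae ?_
      integrable_condExp.integrableOn).2 ?_)
    · refine (ae_restrict_iff' (hG _ hE)).2 ?_
      filter_upwards [hpos] with ω h1 h2
      exact (h1 h2).le
    · refine lt_of_lt_of_le (pos_iff_ne_zero.2 hE0) (measure_mono_ae ?_)
      filter_upwards [hpos] with ω h1 h2
      exact ⟨(h1 h2).ne', h2⟩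
  · rw [← setIntegral_condExp hG hint hBm]
    exact setIntegral_nonpos (hG _ hBm) fun ω hω => (hB hω).2

theorem setIntegral_mul_sub_glue (h1F : HasIndicators mΩ le_rfl LF)
    {φ : LF →ₗ[ℝ] ℝ} {Z : Ω → ℝ} (hZ : Represents Z φ) (X ξ η : LF) {B E : Set Ω}
    (hB : MeasurableSet B) (hE : MeasurableSet E) :
    ∫ ω in B, (Z ω * (X : Ω →ₘ[P] ℝ) ω -
        Z ω * ((glue h1F E hE ξ η : LF) : Ω →ₘ[P] ℝ) ω) ∂P =
      (∫ ω in B ∩ E, (Z ω * (X : Ω →ₘ[P] ℝ) ω - Z ω * (ξ : Ω →ₘ[P] ℝ) ω) ∂P) +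
      ∫ ω in B \ E, (Z ω * (X : Ω →ₘ[P] ℝ) ω - Z ω * (η : Ω →ₘ[P] ℝ) ω) ∂P := by
  have hint : Integrable (fun ω => Z ω * (X : Ω →ₘ[P] ℝ) ω -
      Z ω * ((glue h1F E hE ξ η : LF) : Ω →ₘ[P] ℝ) ω) P := (hZ.2 X).1.sub (hZ.2 _).1
  rw [← integral_inter_add_sdiff hE hint.integrableOn]
  congr 1
  · refine setIntegral_congr_ae (hB.inter hE) ?_
    filter_upwards [coeFn_glue h1F E hE ξ η] with ω h hω
    rw [h.1 hω.2]
  · refine setIntegral_congr_ae (hB.diff hE) ?_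
    filter_upwards [coeFn_glue h1F E hE ξ η] with ω h hω
    rw [h.2 hω.2]

/-- Localization of a strict separation: if `E[Z ξ] < r < E[Z X]` for all `ξ` in a set that is
stable under gluing along `G`, then on some non-null `D ∈ G` the separation is strict on every
non-null `G`-measurable part. -/
theorem exists_set_forall_setIntegral_pos [IsFiniteMeasure P] (hG : G ≤ mΩ)
    (h1F : HasIndicators mΩ le_rfl LF) {C : Set LF}
    (hglue : ∀ E (hE : MeasurableSet[G] E), ∀ ξ ∈ C, ∀ η ∈ C, glue h1F E (hG _ hE) ξ η ∈ C)
    {φ : LF →ₗ[ℝ] ℝ} {Z : Ω → ℝ} (hZ : Represents Z φ) {X ξ₀ : LF} (hξ₀ : ξ₀ ∈ C) {A : Set Ω}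
    (hA : MeasurableSet[G] A)
    (hξ₀X : ∀ᵐ ω ∂P, ω ∉ A → (ξ₀ : Ω →ₘ[P] ℝ) ω = (X : Ω →ₘ[P] ℝ) ω)
    {r : ℝ} (hC : ∀ ξ ∈ C, φ ξ < r) (hX : r < φ X) :
    ∃ D ⊆ A, MeasurableSet[G] D ∧ P D ≠ 0 ∧ ∀ ξ ∈ C, ∀ E ⊆ D, MeasurableSet[G] E → P E ≠ 0 →
      0 < ∫ ω in E, (Z ω * (X : Ω →ₘ[P] ℝ) ω - Z ω * (ξ : Ω →ₘ[P] ℝ) ω) ∂P := by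
  have hint : ∀ ξ : LF,
      Integrable (fun ω => Z ω * (X : Ω →ₘ[P] ℝ) ω - Z ω * (ξ : Ω →ₘ[P] ℝ) ω) P :=
    fun ξ => (hZ.2 X).1.sub (hZ.2 ξ).1
  -- The bad sets are those on which one `ξ ∈ C` matches or beats `X` under `Z` on every
  -- `G`-measurable part; `D` will be what they leave of `A`.
  obtain ⟨s, hsmono, hs, hmax⟩ := exists_monotone_exhausting (P := P)
    {E | MeasurableSet[G] E ∧ E ⊆ A ∧ ∃ ξ ∈ C, ∀ B ⊆ E, MeasurableSet[G] B →
      ∫ ω in B, (Z ω * (X : Ω →ₘ[P] ℝ) ω - Z ω * (ξ : Ω →ₘ[P] ℝ) ω) ∂P ≤ 0}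
    ⟨∅, @MeasurableSet.empty Ω G, Set.empty_subset _, ξ₀, hξ₀, fun B hB _ => by
      simp [Set.subset_empty_iff.1 hB]⟩
    (by
      rintro D ⟨hD, hDA, ξ, hξ, hDξ⟩ E ⟨hE, hEA, η, hη, hEη⟩
      refine ⟨hD.union hE, Set.union_subset hDA hEA, _, hglue D hD ξ hξ η hη, fun B hB hBm => ?_⟩
      rw [setIntegral_mul_sub_glue h1F hZ X ξ η (hG _ hBm) (hG _ hD)]
      refine add_nonpos (hDξ _ Set.inter_subset_right (hBm.inter hD))
        (hEη _ (fun ω hω => (hB hω.1).resolve_left hω.2) (hBm.diff hD)))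
    fun D hD => hG _ hD.1
  have hU : MeasurableSet[G] (⋃ n, s n) := MeasurableSet.iUnion fun n => (hs n).1
  refine ⟨A \ ⋃ n, s n, Set.sdiff_subset, hA.diff hU, fun h0 => ?_,
    fun ξ hξ E hE hEm hE0 => ?_⟩
  -- Suppose the bad sets exhaust `A`. Gluing `ξ n` on `s n` to `ξ₀` elsewhere stays in `C`, which
  -- forces the error over `(s n)ᶜ` to be at least `φ X - r > 0`. That error tends to zero because
  -- `ξ₀ = X` off `A`.
  · choose hsm hsA ξ hξ hsξ using hs
    have hlim : Tendsto (fun n => ∫ ω in (s n)ᶜ,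
        (Z ω * (X : Ω →ₘ[P] ℝ) ω - Z ω * (ξ₀ : Ω →ₘ[P] ℝ) ω) ∂P) atTop (𝓝 0) := by
      have h := tendsto_setIntegral_of_antitone (μ := P) (s := fun n => (s n)ᶜ)
        (f := fun ω => Z ω * (X : Ω →ₘ[P] ℝ) ω - Z ω * (ξ₀ : Ω →ₘ[P] ℝ) ω)
        (fun n => (hG _ (hsm n)).compl) (fun i j hij => Set.compl_subset_compl.2 (hsmono hij))
        ⟨0, (hint ξ₀).integrableOn⟩
      rw [← Set.compl_iUnion] at h
      rwa [setIntegral_eq_zero_of_ae_eq_zero] at h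
      filter_upwards [hξ₀X, measure_eq_zero_iff_ae_notMem.1 h0] with ω h2 h3 h4
      rw [h2 fun h5 => h3 ⟨h5, h4⟩, sub_self]
    have hge : ∀ n, φ X - r ≤ ∫ ω in (s n)ᶜ,
        (Z ω * (X : Ω →ₘ[P] ℝ) ω - Z ω * (ξ₀ : Ω →ₘ[P] ℝ) ω) ∂P := by
      intro n
      have h2 := setIntegral_mul_sub_glue h1F hZ X (ξ n) ξ₀ MeasurableSet.univ (hG _ (hsm n))
      rw [Set.univ_inter, ← Set.compl_eq_univ_sdiff, Measure.restrict_univ,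
        integral_sub (hZ.2 X).1 (hZ.2 _).1, ← (hZ.2 X).2, ← (hZ.2 _).2] at h2
      have h3 := hsξ n _ subset_rfl (hsm n)
      have h4 := hC _ (hglue _ (hsm n) _ (hξ n) _ hξ₀)
      linarith
    linarith [ge_of_tendsto' hlim hge]
  · by_contra! hle
    obtain ⟨E', hE'E, hE'm, hE'0, hE'⟩ :=
      exists_subset_forall_setIntegral_nonpos hG (hint ξ) hEm hE0 hle
    refine hE'0 (measure_mono_null (fun ω hω => ?_) (hmax E'
      ⟨hE'm, fun ω hω => (hE (hE'E hω)).1, ξ, hξ, hE'⟩))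
    exact ⟨hω, (hE (hE'E hω)).2⟩

end Localization

/-! ### Construction of the dual probability. -/

section Core

variable {Ω : Type u} {G : MeasurableSpace Ω} {mΩ : MeasurableSpace Ω} {P : Measure Ω}
  {LF LG : Submodule ℝ (Ω →ₘ[P] ℝ)}

/-- Constant weights `Λ` in (QCO) suffice. -/
theorem CondQuasiconvex.convex_sublevel {π : LF → LG} (hqco : CondQuasiconvex G π)
    (Y : LG) : Convex ℝ {ξ : LF | π ξ ≤ Y} := by
  intro ξ hξ η hη a b ha hb hab
  have hc := AEEqFun.coeFn_const (μ := P) Ω a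
  refine le_trans (hqco ξ η (a • ξ + b • η) (AEEqFun.const Ω a) ?_ ?_ ?_ ?_) (sup_le hξ hη)
  · exact aestronglyMeasurable_const.congr hc.symm
  · rw [← AEEqFun.coeFn_le]
    filter_upwards [hc, AEEqFun.coeFn_zero (α := Ω) (β := ℝ) (μ := P)] with ω h1 h2
    simpa [h1, h2] using ha
  · rw [← AEEqFun.coeFn_le]
    filter_upwards [hc, AEEqFun.coeFn_one (α := Ω) (β := ℝ) (μ := P)] with ω h1 h2
    simp only [h1, h2, Function.const_apply, Pi.one_apply]
    linarith
  · have h1 : (AEEqFun.const Ω a : Ω →ₘ[P] ℝ) * (ξ : Ω →ₘ[P] ℝ) = a • (ξ : Ω →ₘ[P] ℝ) := by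
      refine AEEqFun.ext ?_
      filter_upwards [hc, AEEqFun.coeFn_mul (AEEqFun.const Ω a) (ξ : Ω →ₘ[P] ℝ),
        AEEqFun.coeFn_smul a (ξ : Ω →ₘ[P] ℝ)] with ω h1 h2 h3
      simp [h1, h2, h3]
    have h2 : (1 - AEEqFun.const Ω a : Ω →ₘ[P] ℝ) * (η : Ω →ₘ[P] ℝ) = b • (η : Ω →ₘ[P] ℝ) := by
      refine AEEqFun.ext ?_
      filter_upwards [hc, AEEqFun.coeFn_mul (1 - AEEqFun.const Ω a) (η : Ω →ₘ[P] ℝ),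
        AEEqFun.coeFn_smul b (η : Ω →ₘ[P] ℝ), AEEqFun.coeFn_one (α := Ω) (β := ℝ) (μ := P),
        AEEqFun.coeFn_sub (1 : Ω →ₘ[P] ℝ) (AEEqFun.const Ω a)] with ω h1 h2 h3 h4 h5
      simp [h1, h2, h3, h4, h5, ← hab]
    rw [h1, h2]
    rfl

/-- If `φ` is bounded above on a set that contains `ξ₀ - n η` for all `n`, then `φ η ≥ 0`. -/
theorem nonneg_of_forall_sub_smul_mem {φ : LF →ₗ[ℝ] ℝ} {C : Set LF} {ξ₀ η : LF}
    (hC : ∀ n : ℕ, ξ₀ - (n : ℝ) • η ∈ C) {r : ℝ} (hr : ∀ ξ ∈ C, φ ξ < r) : 0 ≤ φ η := by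
  by_contra! hneg
  obtain ⟨n, hn⟩ := exists_nat_gt ((r - φ ξ₀) / (-φ η))
  have h := hr _ (hC n)
  rw [map_sub, map_smul, smul_eq_mul] at h
  rw [div_lt_iff₀ (by linarith)] at hn
  linarith

/-- If the constraint of `K(X, Q)` is satisfied by `ξ`, then `E_Q[X 𝟏_E] ≤ E_Q[ξ 𝟏_E]` for all
`E ∈ G`. -/
theorem setIntegral_le_of_condExp_le {Q : Measure Ω} [IsFiniteMeasure Q] (hG : G ≤ mΩ)
    {f g : Ω → ℝ} (hf : Integrable f Q) (hg : Integrable g Q) (hfg : Q[f | G] ≤ᵐ[Q] Q[g | G])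
    {E : Set Ω} (hE : MeasurableSet[G] E) : ∫ ω in E, f ω ∂Q ≤ ∫ ω in E, g ω ∂Q := by
  rw [← setIntegral_condExp hG hf hE, ← setIntegral_condExp hG hg hE]
  exact setIntegral_mono_ae integrable_condExp.integrableOn integrable_condExp.integrableOn hfg

/-- If some `π ξ₁` is at most `π X - U` on `A`, where `U > 0`, then there is a dual probability `Q`
for which all competitors in `K(X, Q)` are at least `π X - U` on a non-null part of `A`. -/
theorem exists_dualProbability_forall_le [IsProbabilityMeasure P] (hG : G ≤ mΩ)
    (hLF : IsVectorLattice LF) (hLGmeas : ∀ Y ∈ LG, AEStronglyMeasurable[G] Y P)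
    (h1F : HasIndicators mΩ le_rfl LF) (h1G : HasIndicators G hG LG) (hdual : DualInL1 LF)
    {π : LF → LG} (hmon : Monotone π) (hqco : CondQuasiconvex G π) (hreg : Regular G hG π)
    (hlsc : WeaklyLSC π) (X ξ₁ : LF) (U : LG) {A : Set Ω} (hA : MeasurableSet[G] A)
    (hA0 : P A ≠ 0) (hU : ∀ᵐ ω ∂P, ω ∈ A → 0 < (U : Ω →ₘ[P] ℝ) ω)
    (hξ₁ : ∀ᵐ ω ∂P, ω ∈ A →
      (π ξ₁ : Ω →ₘ[P] ℝ) ω ≤ (π X : Ω →ₘ[P] ℝ) ω - (U : Ω →ₘ[P] ℝ) ω) :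
    ∃ Q ∈ dualProbabilities LF, ∃ D ⊆ A, MeasurableSet[G] D ∧ P D ≠ 0 ∧
      ∀ ξ : LF, Q[((X : Ω →ₘ[P] ℝ) : Ω → ℝ) | G] ≤ᵐ[Q] Q[((ξ : Ω →ₘ[P] ℝ) : Ω → ℝ) | G] →
        ∀ᵐ ω ∂P, ω ∈ D →
          (π X : Ω →ₘ[P] ℝ) ω - (U : Ω →ₘ[P] ℝ) ω ≤ (π ξ : Ω →ₘ[P] ℝ) ω := by
  let Y : LG := π X - ⟨restr U A (hG _ hA), h1G U U.2 A hA⟩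
  have hY : ∀ᵐ ω ∂P,
      (ω ∈ A → (Y : Ω →ₘ[P] ℝ) ω = (π X : Ω →ₘ[P] ℝ) ω - (U : Ω →ₘ[P] ℝ) ω) ∧
      (ω ∉ A → (Y : Ω →ₘ[P] ℝ) ω = (π X : Ω →ₘ[P] ℝ) ω) := by
    filter_upwards [AEEqFun.coeFn_sub (π X : Ω →ₘ[P] ℝ) (restr U A (hG _ hA)),
      coeFn_restr (U : Ω →ₘ[P] ℝ) A (hG _ hA)] with ω h1 h2
    have h3 : (Y : Ω →ₘ[P] ℝ) ω = _ := h1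
    rw [h3, Pi.sub_apply, h2]
    constructor <;> intro h <;> simp [h]
  have hmem : ∀ ξ : LF, π ξ ≤ Y ↔ ∀ᵐ ω ∂P, (π ξ : Ω →ₘ[P] ℝ) ω ≤ (Y : Ω →ₘ[P] ℝ) ω :=
    fun ξ => AEEqFun.coeFn_le.symm
  have hglue : ∀ E (hE : MeasurableSet[G] E), ∀ ξ ∈ {ξ : LF | π ξ ≤ Y}, ∀ η ∈ {ξ : LF | π ξ ≤ Y},
      glue h1F E (hG _ hE) ξ η ∈ {ξ : LF | π ξ ≤ Y} := by
    intro E hE ξ hξ η hη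
    refine (hmem _).2 ?_
    filter_upwards [hreg.coeFn_glue h1F E hE ξ η, (hmem ξ).1 hξ, (hmem η).1 hη] with ω h1 h2 h3
    by_cases hω : ω ∈ E
    · rwa [h1.1 hω]
    · rwa [h1.2 hω]
  -- Since `Y` equals `π X` off `A`, this shows that the sublevel set is nonempty, by an element
  -- that agrees with `X` off `A`.
  let ξ₀ : LF := glue h1F A (hG _ hA) ξ₁ X
  have hξ₀ : ξ₀ ∈ {ξ : LF | π ξ ≤ Y} := by
    refine (hmem _).2 ?_
    filter_upwards [hreg.coeFn_glue h1F A hA ξ₁ X, hY, hξ₁] with ω h1 h2 h3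
    by_cases hω : ω ∈ A
    · rw [h1.1 hω, h2.1 hω]
      exact h3 hω
    · rw [h1.2 hω, h2.2 hω]
  have hX : X ∉ {ξ : LF | π ξ ≤ Y} := by
    intro hX
    refine hA0 (measure_eq_zero_iff_ae_notMem.2 ?_)
    filter_upwards [hU, (hmem X).1 hX, hY] with ω h1 h2 h3 hω
    rw [h3.1 hω] at h2
    linarith [h1 hω]
  obtain ⟨φ, hφ, r, hφC, hφX⟩ :=
    exists_orderDual_separating (hqco.convex_sublevel Y) (hlsc Y) hX
  have hφpos : ∀ η : LF, 0 ≤ η → 0 ≤ φ η := by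
    intro η hη
    refine nonneg_of_forall_sub_smul_mem (ξ₀ := ξ₀) (C := {ξ : LF | π ξ ≤ Y})
      (fun n => le_trans (hmon (a := ξ₀ - (n : ℝ) • η) (b := ξ₀) (AEEqFun.coeFn_le.1 ?_)) hξ₀) hφC
    have hη' : ((0 : Ω →ₘ[P] ℝ) : Ω → ℝ) ≤ᵐ[P] (η : Ω →ₘ[P] ℝ) := AEEqFun.coeFn_le.2 hη
    filter_upwards [hη', AEEqFun.coeFn_zero (α := Ω) (β := ℝ) (μ := P),
      AEEqFun.coeFn_sub (ξ₀ : Ω →ₘ[P] ℝ) ((n : ℝ) • (η : Ω →ₘ[P] ℝ)),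
      AEEqFun.coeFn_smul (n : ℝ) (η : Ω →ₘ[P] ℝ)] with ω h1 h2 h3 h4
    refine h3.trans_le ?_
    rw [h2] at h1
    rw [Pi.sub_apply, h4]
    exact sub_le_self _ (mul_nonneg n.cast_nonneg h1)
  obtain ⟨Z₀, hZ₀⟩ := hdual φ hφ
  obtain ⟨Z, hZpos, hZ⟩ := exists_nonneg_represents h1F hLF hφpos hZ₀
  obtain ⟨D, hDA, hD, hD0, hDint⟩ := exists_set_forall_setIntegral_pos hG h1F hglue hZ hξ₀ hA
    (by filter_upwards [coeFn_glue h1F A (hG _ hA) ξ₁ X] with ω h using h.2) hφC hφX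
  have hDZ : 0 < ∫ ω in D, Z ω ∂P := by
    refine lt_of_le_of_ne (integral_nonneg hZpos) fun h0 => ?_
    have hZ0 := (integral_eq_zero_iff_of_nonneg hZpos hZ.1.integrableOn).1 h0.symm
    refine (hDint ξ₀ hξ₀ D subset_rfl hD hD0).ne' (integral_eq_zero_of_ae ?_)
    filter_upwards [hZ0] with ω h
    simp [h]
  obtain ⟨Q, hQ, c, hc, hQX⟩ := exists_dualProbability
    (comp_cut_mem_orderDual h1F D (hG _ hD) hφ) (hZ.cut h1F D (hG _ hD))
    (Eventually.of_forall fun ω => Set.indicator_nonneg (fun ω _ => hZpos ω) ω)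
    (by rwa [integral_indicator (hG _ hD)])
  have hQfin : IsProbabilityMeasure Q := hQ.1
  refine ⟨Q, hQ, D, hDA, hD, hD0, fun ξ hξ => ?_⟩
  have hdm := hLGmeas _ (π ξ - Y).2
  have hTm : MeasurableSet[G] {ω | hdm.mk _ ω ≤ 0} :=
    hdm.stronglyMeasurable_mk.measurable measurableSet_Iic
  have hd : ∀ᵐ ω ∂P, hdm.mk _ ω = (π ξ : Ω →ₘ[P] ℝ) ω - (Y : Ω →ₘ[P] ℝ) ω := by
    filter_upwards [hdm.ae_eq_mk, AEEqFun.coeFn_sub (π ξ : Ω →ₘ[P] ℝ) (Y : Ω →ₘ[P] ℝ)]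
      with ω h1 h2
    rw [← h1]
    exact h2
  -- A `G`-measurable version of `π ξ - Y` puts `D'` in `G`. Gluing `ξ` on `D'` to `ξ₀` gives a
  -- member of the sublevel set, so if `D'` were non-null, strict separation on it would contradict
  -- the constraint on `ξ`.
  set D' := D ∩ {ω | hdm.mk _ ω ≤ 0} with hD'
  have hD'm : MeasurableSet[G] D' := hD.inter hTm
  have hnull : P D' = 0 := by
    by_contra h0
    have hmemC : glue h1F D' (hG _ hD'm) ξ ξ₀ ∈ {ξ : LF | π ξ ≤ Y} := by
      refine (hmem _).2 ?_
      filter_upwards [hreg.coeFn_glue h1F D' hD'm ξ ξ₀, (hmem ξ₀).1 hξ₀, hd] with ω h1 h2 h3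
      by_cases hω : ω ∈ D'
      · rw [h1.1 hω]
        have h4 : hdm.mk _ ω ≤ 0 := hω.2
        linarith
      · rwa [h1.2 hω]
    have h2 := hDint _ hmemC D' Set.inter_subset_left hD'm h0
    rw [setIntegral_mul_sub_glue h1F hZ X ξ ξ₀ (hG _ hD'm) (hG _ hD'm), Set.inter_self,
      Set.sdiff_self, setIntegral_empty, add_zero,
      integral_sub (hZ.2 X).1.integrableOn (hZ.2 ξ).1.integrableOn] at h2
    have h3 := setIntegral_le_of_condExp_le hG (hQX X).1 (hQX ξ).1 hξ hD'm
    rw [(hQX X).2 _ (hG _ hD'm), (hQX ξ).2 _ (hG _ hD'm)] at h3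
    have h4 : ∀ W : LF, ∫ ω in D', D.indicator Z ω * (W : Ω →ₘ[P] ℝ) ω ∂P =
        ∫ ω in D', Z ω * (W : Ω →ₘ[P] ℝ) ω ∂P := fun W =>
      setIntegral_congr_fun (hG _ hD'm) fun ω hω => by
        simp only [Set.indicator_of_mem hω.1]
    rw [h4, h4] at h3
    linarith [le_of_mul_le_mul_left h3 hc]
  filter_upwards [measure_eq_zero_iff_ae_notMem.1 hnull, hd, hY] with ω h1 h2 h3 hω
  have h4 : ¬ hdm.mk _ ω ≤ 0 := fun h => h1 ⟨hω, h⟩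
  rw [← h3.1 (hDA hω)]
  linarith

end Core

/-! ### Lower bounds for `K` and existence of dual probabilities. -/

section Representation

variable {Ω : Type u} {G : MeasurableSpace Ω} {mΩ : MeasurableSpace Ω} {P : Measure Ω}
  {LF LG : Submodule ℝ (Ω →ₘ[P] ℝ)}

theorem coeFn_toExt (X : Ω →ₘ[P] ℝ) : ∀ᵐ ω ∂P, toExt X ω = (X ω : EReal) :=
  AEEqFun.coeFn_comp _ continuous_coe_real_ereal X

/-- A lower bound on `D` of all competitors in `K(X, Q)` is a lower bound on `D` of `K(X, Q)`. -/
theorem ae_le_K [IsFiniteMeasure P] {π : LF → LG} {X : LF} {Q : Measure Ω} {D : Set Ω}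
    (hD : MeasurableSet D) (V : Ω →ₘ[P] ℝ)
    (h : ∀ ξ : LF, Q[((X : Ω →ₘ[P] ℝ) : Ω → ℝ) | G] ≤ᵐ[Q] Q[((ξ : Ω →ₘ[P] ℝ) : Ω → ℝ) | G] →
      ∀ᵐ ω ∂P, ω ∈ D → V ω ≤ (π ξ : Ω →ₘ[P] ℝ) ω) :
    ∀ᵐ ω ∂P, ω ∈ D → (V ω : EReal) ≤ K G π X Q ω := by
  classical
  -- The value `⊥` off `D` turns the local bound into a global one, to which the greatest lower
  -- bound property applies.
  have hm : AEStronglyMeasurable (D.piecewise (fun ω => (V ω : EReal)) fun _ => ⊥) P :=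
    (Measurable.piecewise hD (measurable_coe_real_ereal.comp V.measurable)
      measurable_const).aestronglyMeasurable
  have hle : AEEqFun.mk _ hm ≤ K G π X Q := by
    refine (isGLB_essInfFamily P _).2 ?_
    rintro _ ⟨ξ, hξ, rfl⟩
    rw [← AEEqFun.coeFn_le]
    filter_upwards [AEEqFun.coeFn_mk _ hm, coeFn_toExt (π ξ : Ω →ₘ[P] ℝ), h ξ hξ] with ω h1 h2 h3
    rw [h1, h2]
    by_cases hω : ω ∈ D
    · simpa [hω] using h3 hω
    · simp [hω]
  filter_upwards [AEEqFun.coeFn_le.2 hle, AEEqFun.coeFn_mk _ hm] with ω h1 h2 hω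
  rw [h2, Set.piecewise_eq_of_mem _ _ _ hω] at h1
  exact h1

theorem K_le [IsFiniteMeasure P] (π : LF → LG) (X : LF) (Q : Measure Ω) :
    K G π X Q ≤ toExt (π X : Ω →ₘ[P] ℝ) :=
  (isGLB_essInfFamily P _).1 ⟨X, EventuallyLE.refl _ _, rfl⟩

/-- Supplies a `Q` where no separation is needed. A functional that is nonzero at some point has a
nonzero density; cut it, or its negative, to where it is positive and normalize. If `LF` is trivial,
the density `1` represents the zero functional. -/
theorem dualProbabilities_nonempty [IsProbabilityMeasure P] (h1F : HasIndicators mΩ le_rfl LF)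
    (hdual : DualInL1 LF) (hsep : DualSeparates LF) : (dualProbabilities LF).Nonempty := by
  by_cases hex : ∃ X : LF, X ≠ 0
  · obtain ⟨X, hX⟩ := hex
    obtain ⟨φ, hφ, hφX⟩ := hsep X hX
    obtain ⟨Z, hZ⟩ := hdual φ hφ
    obtain ⟨W, hWm, hWe⟩ := hZ.1.aestronglyMeasurable
    have hW := hZ.congr hWe
    have main : ∀ (ψ : LF →ₗ[ℝ] ℝ) (V : Ω → ℝ), ψ ∈ orderDual LF → StronglyMeasurable V →
        Represents V ψ → P {ω | 0 < V ω} ≠ 0 → (dualProbabilities LF).Nonempty := by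
      intro ψ V hψ hVm hV h0
      have hD : MeasurableSet {ω | 0 < V ω} := hVm.measurable measurableSet_Ioi
      have hnn : 0 ≤ {ω | 0 < V ω}.indicator V := Set.indicator_nonneg fun ω hω => le_of_lt hω
      obtain ⟨Q, hQ, -⟩ := exists_dualProbability (comp_cut_mem_orderDual h1F _ hD hψ)
        (hV.cut h1F _ hD) (Eventually.of_forall hnn) (by
          rw [integral_pos_iff_support_of_nonneg hnn (hV.1.indicator hD)]
          refine lt_of_lt_of_le (pos_iff_ne_zero.2 h0) (measure_mono fun ω hω => ?_)
          rw [Function.mem_support, Set.indicator_of_mem hω]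
          exact ne_of_gt hω)
      exact ⟨Q, hQ⟩
    by_cases hp : P {ω | 0 < W ω} = 0
    · by_cases hn : P {ω | 0 < -1 * W ω} = 0
      · refine absurd ?_ hφX
        rw [(hW.2 X).2]
        refine integral_eq_zero_of_ae ?_
        filter_upwards [measure_eq_zero_iff_ae_notMem.1 hp, measure_eq_zero_iff_ae_notMem.1 hn]
          with ω h1 h2
        simp only [not_lt] at h1 h2
        have h3 : W ω = 0 := by linarith
        simp [h3]
      · exact main _ _ (Submodule.smul_mem _ (-1) hφ) (hWm.const_mul (-1)) (hW.smul (-1)) hn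
    · exact main _ _ hφ hWm hW hp
  · push Not at hex
    have hrep : Represents (P := P) (L := LF) (fun _ => (1 : ℝ)) 0 := by
      refine ⟨integrable_const _, fun X => ?_⟩
      have hX : (fun ω => 1 * (X : Ω →ₘ[P] ℝ) ω) =ᵐ[P] 0 := by
        rw [hex X]
        filter_upwards [AEEqFun.coeFn_zero (α := Ω) (β := ℝ) (μ := P)] with ω h
        rw [Submodule.coe_zero, h, Pi.zero_apply, mul_zero]
      exact ⟨(integrable_zero Ω ℝ P).congr hX.symm, by
        rw [integral_congr_ae hX]
        simp⟩
    obtain ⟨Q, hQ, -⟩ := exists_dualProbability (Submodule.zero_mem _) hrep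
      (Eventually.of_forall fun _ => zero_le_one) (by simp)
    exact ⟨Q, hQ⟩

/-- A property of a `G`-measurable random variable that holds on no non-null `B' ⊆ B`, `B' ∈ G`,
fails almost everywhere on `B`. -/
theorem ae_not_of_forall_subset_null {V : Ω →ₘ[P] ℝ}
    (hV : AEStronglyMeasurable[G] V P) {p : ℝ → Prop} (hp : MeasurableSet {x | p x}) {B : Set Ω} (hB : MeasurableSet[G] B)
    (h : ∀ B' ⊆ B, MeasurableSet[G] B' → (∀ᵐ ω ∂P, ω ∈ B' → p (V ω)) → P B' = 0) :
    ∀ᵐ ω ∂P, ω ∈ B → ¬ p (V ω) := by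
  have hm : MeasurableSet[G] {ω | p (hV.mk _ ω)} := hV.stronglyMeasurable_mk.measurable hp
  have h0 := h (B ∩ {ω | p (hV.mk _ ω)}) Set.inter_subset_left (hB.inter hm) (by
    filter_upwards [hV.ae_eq_mk] with ω h1 h2
    rw [h1]
    exact h2.2)
  filter_upwards [measure_eq_zero_iff_ae_notMem.1 h0, hV.ae_eq_mk] with ω h1 h2 hω h3
  rw [h2] at h3
  exact h1 ⟨hω, h3⟩

end Representation
end QuasiconvexDual

/-! ### The dual representation. -/

open QuasiconvexDual in
theorem theorem1 {Ω : Type u} (G : MeasurableSpace Ω) {mΩ : MeasurableSpace Ω} (P : MeasureTheory.Measure Ω)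
    [MeasureTheory.IsProbabilityMeasure P] (hG : G ≤ mΩ)
    (LF LG : Submodule ℝ (Ω →ₘ[P] ℝ))
    (hLF : QuasiconvexDual.IsVectorLattice LF) (hLG : QuasiconvexDual.IsVectorLattice LG)
    (hLGmeas : ∀ Y ∈ LG, AEStronglyMeasurable[G] Y P)
    (h1F : QuasiconvexDual.HasIndicators mΩ le_rfl LF)
    (h1G : QuasiconvexDual.HasIndicators G hG LG)
    (hdual : QuasiconvexDual.DualInL1 LF) (hsep : QuasiconvexDual.DualSeparates LF)
    (π : LF → LG) (hmon : Monotone π) (hqco : QuasiconvexDual.CondQuasiconvex G π)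
    (hreg : QuasiconvexDual.Regular G hG π) (hlsc : QuasiconvexDual.WeaklyLSC π) (X : LF) :
    IsLUB {Y | ∃ Q ∈ QuasiconvexDual.dualProbabilities LF, Y = QuasiconvexDual.K G π X Q}
      (QuasiconvexDual.toExt (π X : Ω →ₘ[P] ℝ)) := by
  refine ⟨?_, fun S hS => ?_⟩
  · rintro _ ⟨Q, -, rfl⟩
    exact K_le π X Q
  obtain ⟨Q₀, hQ₀⟩ := dualProbabilities_nonempty h1F hdual hsep
  have hKS : ∀ Q ∈ dualProbabilities LF, ∀ᵐ ω ∂P, K G π X Q ω ≤ S ω := fun Q hQ =>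
    AEEqFun.coeFn_le.2 (hS ⟨Q, hQ, rfl⟩)
  have hlow : ∀ (U : LG) (A : Set Ω), MeasurableSet[G] A →
      (∀ᵐ ω ∂P, ω ∈ A → 0 < (U : Ω →ₘ[P] ℝ) ω) →
      ∀ᵐ ω ∂P, ω ∈ A → (((π X : Ω →ₘ[P] ℝ) ω - (U : Ω →ₘ[P] ℝ) ω : ℝ) : EReal) ≤ S ω := by
    intro U A hA hU
    have hV := AEEqFun.coeFn_sub (π X : Ω →ₘ[P] ℝ) (U : Ω →ₘ[P] ℝ)
    have hfin : ∀ Q ∈ dualProbabilities LF, ∀ D, MeasurableSet[G] D →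
        (∀ ξ : LF, Q[((X : Ω →ₘ[P] ℝ) : Ω → ℝ) | G] ≤ᵐ[Q] Q[((ξ : Ω →ₘ[P] ℝ) : Ω → ℝ) | G] →
          ∀ᵐ ω ∂P, ω ∈ D →
            (π X : Ω →ₘ[P] ℝ) ω - (U : Ω →ₘ[P] ℝ) ω ≤ (π ξ : Ω →ₘ[P] ℝ) ω) →
        ∀ᵐ ω ∂P, ω ∈ D → (((π X : Ω →ₘ[P] ℝ) ω - (U : Ω →ₘ[P] ℝ) ω : ℝ) : EReal) ≤ S ω := by
      intro Q hQ D hD h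
      have hK := ae_le_K (G := G) (π := π) (X := X) (Q := Q) (hG _ hD)
        ((π X : Ω →ₘ[P] ℝ) - (U : Ω →ₘ[P] ℝ)) (by
          intro ξ hξ
          filter_upwards [h ξ hξ, hV] with ω h1 h2 hω
          rw [h2]
          exact h1 hω)
      filter_upwards [hK, hKS Q hQ, hV] with ω h1 h2 h3 hω
      have h4 := (h1 hω).trans h2
      rwa [h3] at h4
    refine ae_mem_imp_of_forall_exists_subset hG hA fun B hBA hB hB0 => ?_
    -- If no `π ξ` drops to `π X - U` on a non-null part of `B`, the bound on `B` holds for any dual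
    -- probability, in particular `Q₀`.
    by_cases hex : ∃ ξ : LF, ∃ B' ⊆ B, MeasurableSet[G] B' ∧ P B' ≠ 0 ∧ ∀ᵐ ω ∂P, ω ∈ B' →
        (π ξ : Ω →ₘ[P] ℝ) ω ≤ (π X : Ω →ₘ[P] ℝ) ω - (U : Ω →ₘ[P] ℝ) ω
    · obtain ⟨ξ, B', hB'B, hB', hB'0, hξ⟩ := hex
      obtain ⟨Q, hQ, D, hDB', hD, hD0, h⟩ := exists_dualProbability_forall_le hG hLF hLGmeas h1F
        h1G hdual hmon hqco hreg hlsc X ξ U hB' hB'0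
        (by filter_upwards [hU] with ω h1 h2 using h1 (hBA (hB'B h2))) hξ
      exact ⟨D, hDB'.trans hB'B, hD, hD0, hfin Q hQ D hD h⟩
    · refine ⟨B, subset_rfl, hB, hB0, hfin Q₀ hQ₀ B hB fun ξ _ => ?_⟩
      have hd : ∀ᵐ ω ∂P, ((π ξ - (π X - U) : LG) : Ω →ₘ[P] ℝ) ω =
          (π ξ : Ω →ₘ[P] ℝ) ω - ((π X : Ω →ₘ[P] ℝ) ω - (U : Ω →ₘ[P] ℝ) ω) := by
        filter_upwards [hV, AEEqFun.coeFn_sub (π ξ : Ω →ₘ[P] ℝ)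
          ((π X : Ω →ₘ[P] ℝ) - (U : Ω →ₘ[P] ℝ))] with ω h1 h2
        refine h2.trans ?_
        rw [Pi.sub_apply, h1, Pi.sub_apply]
      have hneg := ae_not_of_forall_subset_null (hLGmeas _ (π ξ - (π X - U)).2)
        (p := fun x => x ≤ 0) measurableSet_Iic hB (by
          intro B' hB'B hB' hle
          by_contra hB'0
          refine hex ⟨ξ, B', hB'B, hB', hB'0, ?_⟩
          filter_upwards [hle, hd] with ω h1 h2 hω
          linarith [h1 hω])
      filter_upwards [hneg, hd] with ω h1 h2 hω
      linarith [not_le.1 (h1 hω)]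
  have hpos : ∀ (U : LG) (A : Set Ω), MeasurableSet[G] A →
      (∀ᵐ ω ∂P, ω ∈ A → 0 < (U : Ω →ₘ[P] ℝ) ω) →
      ∀ᵐ ω ∂P, ω ∈ A → (((π X : Ω →ₘ[P] ℝ) ω : ℝ) : EReal) ≤ S ω := by
    intro U A hA hU
    have hsmul : ∀ n : ℕ, ∀ᵐ ω ∂P, (((1 / ((n : ℝ) + 1)) • U : LG) : Ω →ₘ[P] ℝ) ω =
        1 / ((n : ℝ) + 1) * (U : Ω →ₘ[P] ℝ) ω := fun n =>
      AEEqFun.coeFn_smul (1 / ((n : ℝ) + 1)) (U : Ω →ₘ[P] ℝ)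
    have hall := ae_all_iff.2 fun n : ℕ => hlow ((1 / ((n : ℝ) + 1)) • U) A hA (by
      filter_upwards [hU, hsmul n] with ω h1 h2 hω
      rw [h2]
      have := h1 hω
      positivity)
    filter_upwards [hall, ae_all_iff.2 hsmul] with ω h1 h2 hω
    have hlim : Tendsto (fun n : ℕ => (π X : Ω →ₘ[P] ℝ) ω -
        1 / ((n : ℝ) + 1) * (U : Ω →ₘ[P] ℝ) ω) atTop (𝓝 ((π X : Ω →ₘ[P] ℝ) ω)) := by
      simpa using tendsto_const_nhds.sub
        ((tendsto_one_div_add_atTop_nhds_zero_nat (𝕜 := ℝ)).mul_const ((U : Ω →ₘ[P] ℝ) ω))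
    refine le_of_tendsto' ((continuous_coe_real_ereal.tendsto _).comp hlim) fun n => ?_
    have h3 := h1 n hω
    rwa [h2 n] at h3
  have huniv : ∀ᵐ ω ∂P, ω ∈ Set.univ → (((π X : Ω →ₘ[P] ℝ) ω : ℝ) : EReal) ≤ S ω := by
    refine ae_mem_imp_of_forall_exists_subset hG MeasurableSet.univ fun B _ hB hB0 => ?_
    -- `LG` need not contain a strictly positive element. Where no member is positive on a non-null
    -- part of `B`, applying this to `π X - π ξ` gives `π X ≤ π ξ` on `B` for all `ξ`, so again `Q₀`
    -- works.
    by_cases hex : ∃ U : LG, ∃ B' ⊆ B, MeasurableSet[G] B' ∧ P B' ≠ 0 ∧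
        ∀ᵐ ω ∂P, ω ∈ B' → 0 < (U : Ω →ₘ[P] ℝ) ω
    · obtain ⟨U, B', hB'B, hB', hB'0, hU⟩ := hex
      exact ⟨B', hB'B, hB', hB'0, hpos U B' hB' hU⟩
    · have hnonpos : ∀ U : LG, ∀ᵐ ω ∂P, ω ∈ B → (U : Ω →ₘ[P] ℝ) ω ≤ 0 := by
        intro U
        have hneg := ae_not_of_forall_subset_null (hLGmeas _ U.2)
          (p := fun x => 0 < x) measurableSet_Ioi hB (by
            intro B' hB'B hB' hlt
            by_contra hB'0
            exact hex ⟨U, B', hB'B, hB', hB'0, hlt⟩)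
        filter_upwards [hneg] with ω h1 hω
        exact not_lt.1 (h1 hω)
      refine ⟨B, subset_rfl, hB, hB0, ?_⟩
      have hK := ae_le_K (G := G) (π := π) (X := X) (Q := Q₀) (hG _ hB) (π X : Ω →ₘ[P] ℝ) (by
        intro ξ _
        filter_upwards [hnonpos (π X - π ξ),
          AEEqFun.coeFn_sub (π X : Ω →ₘ[P] ℝ) (π ξ : Ω →ₘ[P] ℝ)] with ω h1 h2 hω
        have h3 : (π X : Ω →ₘ[P] ℝ) ω - (π ξ : Ω →ₘ[P] ℝ) ω ≤ 0 := h2.symm.trans_le (h1 hω)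
        linarith)
      filter_upwards [hK, hKS Q₀ hQ₀] with ω h1 h2 hω
      exact (h1 hω).trans h2
  rw [← AEEqFun.coeFn_le]
  filter_upwards [huniv, coeFn_toExt (π X : Ω →ₘ[P] ℝ)] with ω h1 h2
  rw [h2]
  exact h1 (Set.mem_univ ω)
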